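/- Let $\mathbf{W}^*$ be the category whose objects are the Archimedean real vector lattices with a distinguished strong unit and whose morphisms are the unit-preserving vector lattice homomorphisms. A morphism $f\colon A\to B$ is an \emph{essential embedding}, and $(B,f)$ an \emph{essential extension} of $A$, if $f$ is injective and every morphism $g\colon B\to C$ with $g\circ f$ injective is itself injective. For essential extensions of $A$ write $(B_1,f_1)\le(B_2,f_2)$ if $f_2=f\circ f_1$ for some morphism $f\colon B_1\to B_2$; the \emph{essential completion} $(eA,e_A)$ of $A$ is the maximum essential extension of $A$ (it is unique up to isomorphism over $A$). For a compact Hausdorff space $X$, let $C(X)$ be the vector lattice of all continuous functions $X\to\mathbb{R}$, and $F(X)\subseteq C(X)$ the vector lattice of those with finite range, both with the constant function $1$ as strong unit. Let $E$ be an infinite, compact Hausdorff, extremally disconnected space. Let $\mathcal{V}(C(E),e)$ be the collection of all $A\in\mathbf{W}^*$ with $eA=C(E)$, each taken together with its embedding $e_A\colon A\to C(E)$ (that is, of all pairs $(A,f)$ with $f\colon A\to C(E)$ such that $(C(E),f)$ is the essential completion of $A$). It is preordered by: $(A_1,f_1)\le(A_2,f_2)$ if there is an essential embedding $f\colon A_1\to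 A_2$ with $f_1=f_2\circ f$; and it is regarded as a poset by identifying $(A_1,f_1)$ with $(A_2,f_2)$ whenever $(A_1,f_1)\le(A_2,f_2)\le(A_1,f_1)$. Then the poset $\mathcal{V}(C(E),e)$ has a minimum if and only if $E$ is homeomorphic to the Čech–Stone compactification $\beta D$ of some discrete space $D$. In that case the minimum is $F(\alpha D)$, where $\alpha D$ is the one-point compactification of $D$: precisely, for every discrete space $D$ and every homeomorphism $\varphi\colon E\to\beta D$, the minimum is $F(\alpha D)$ together with the embedding $F(\alpha D)\to C(E)$, $f\mapsto f\circ\tau\circ\varphi$, where $\tau\colon\beta D\to\alpha D$ is the continuous extension of the inclusion $D\to\alpha D$. -/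

import Mathlib

universe u

/-- An object of the category `W*`: an Archimedean (real) vector lattice with a distinguished
strong unit. -/
structure WStar where
  /-- the underlying set -/
  carrier : Type u
  [addCommGroup : AddCommGroup carrier]
  [lattice : Lattice carrier]
  [isOrderedAddMonoid : IsOrderedAddMonoid carrier]
  [module : Module ℝ carrier]
  [isOrderedModule : IsOrderedModule ℝ carrier]
  /-- the Archimedean property of vector lattices -/
  archimedean : ∀ a b : carrier, 0 ≤ a → (∀ n : ℕ, n • a ≤ b) → a = 0
  /-- the distinguished strong unit -/
  unit : carrier
  unit_nonneg : 0 ≤ unit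
  unit_strong : ∀ a : carrier, ∃ n : ℕ, |a| ≤ n • unit

namespace WStar

instance : CoeSort WStar.{u} (Type u) := ⟨WStar.carrier⟩

attribute [instance] addCommGroup lattice isOrderedAddMonoid module isOrderedModule

/-- The morphisms of `W*`: unit-preserving vector lattice homomorphisms. -/
structure Hom (A B : WStar.{u}) extends A.carrier →ₗ[ℝ] B.carrier where
  map_sup' : ∀ a b : A.carrier, toFun (a ⊔ b) = toFun a ⊔ toFun b
  map_inf' : ∀ a b : A.carrier, toFun (a ⊓ b) = toFun a ⊓ toFun b
  map_unit' : toFun A.unit = B.unit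

instance (A B : WStar.{u}) : FunLike (Hom A B) A.carrier B.carrier where
  coe f := f.toFun
  coe_injective f g h := by
    rcases f with ⟨f, _, _, _⟩
    rcases g with ⟨g, _, _, _⟩
    have : f = g := LinearMap.ext fun x => congrFun h x
    subst this
    rfl

/-- The identity morphism. -/
def Hom.id (A : WStar.{u}) : Hom A A where
  toLinearMap := LinearMap.id
  map_sup' _ _ := rfl
  map_inf' _ _ := rfl
  map_unit' := rfl

/-- Composition of morphisms: `g` after `f`. -/
def Hom.comp {A B C : WStar.{u}} (g : Hom B C) (f : Hom A B) : Hom A C where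
  toLinearMap := g.toLinearMap.comp f.toLinearMap
  map_sup' a b := by
    change g.toFun (f.toFun (a ⊔ b)) = g.toFun (f.toFun a) ⊔ g.toFun (f.toFun b)
    rw [f.map_sup', g.map_sup']
  map_inf' a b := by
    change g.toFun (f.toFun (a ⊓ b)) = g.toFun (f.toFun a) ⊓ g.toFun (f.toFun b)
    rw [f.map_inf', g.map_inf']
  map_unit' := by
    change g.toFun (f.toFun A.unit) = C.unit
    rw [f.map_unit', g.map_unit']

/-- `f : A → B` is an essential embedding: it is an embedding, and every morphism out of `B` whose
composite with `f` is monic (that is, injective) is itself monic. -/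
def Hom.IsEssential {A B : WStar.{u}} (f : Hom A B) : Prop :=
  Function.Injective f ∧
    ∀ (C : WStar.{u}) (g : Hom B C), Function.Injective (g.comp f) → Function.Injective g

theorem Hom.IsEssential.id (A : WStar.{u}) : (Hom.id A).IsEssential :=
  ⟨fun _ _ h => h, fun _ _ h => h⟩

theorem Hom.IsEssential.comp {A B C : WStar.{u}} {g : Hom B C} {f : Hom A B}
    (hg : g.IsEssential) (hf : f.IsEssential) : (g.comp f).IsEssential :=
  ⟨fun _ _ h => hf.1 (hg.1 h), fun D k h => hg.2 D k (hf.2 D (k.comp g) h)⟩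

/-- `(B, f)` is the essential completion `(eA, e_A)` of `A`: it is an essential extension of `A`,
and it is the largest one, where `(B₁, f₁) ≤ (B₂, f₂)` for essential extensions of `A` means that
there is a morphism `h : B₁ → B₂` with `f₂ = h ∘ f₁`. -/
def Hom.IsEssentialCompletion {A B : WStar.{u}} (f : Hom A B) : Prop :=
  f.IsEssential ∧
    ∀ (B' : WStar.{u}) (f' : Hom A B'), f'.IsEssential → ∃ h : Hom B' B, f = h.comp f'

/-- The objects `A` with `eA = H`, each taken together with its embedding `e_A : A → H`. -/
structure EssCompletedBy (H : WStar.{u}) where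
  /-- the object `A` -/
  obj : WStar.{u}
  /-- the embedding `e_A : A → H` -/
  emb : Hom obj H
  isEssentialCompletion : emb.IsEssentialCompletion

/-- `(A₁, f₁) ≤ (A₂, f₂)` when there is an essential embedding `f : A₁ → A₂` with
`f₁ = f₂ ∘ f`. -/
instance (H : WStar.{u}) : Preorder (EssCompletedBy H) where
  le p q := ∃ f : Hom p.obj q.obj, f.IsEssential ∧ p.emb = q.emb.comp f
  le_refl p := ⟨Hom.id p.obj, Hom.IsEssential.id _, rfl⟩
  le_trans p q r := by
    rintro ⟨f, hf, hpq⟩ ⟨g, hg, hqr⟩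
    exact ⟨g.comp f, hg.comp hf, by rw [hpq, hqr]; rfl⟩

/-- The poset of the `A` in `W*` with `eA = H`: the preorder above, up to the induced
equivalence. -/
abbrev EssPoset (H : WStar.{u}) : Type (u + 1) :=
  Antisymmetrization (EssCompletedBy H) (· ≤ ·)

section Functions

variable (X : Type u) [TopologicalSpace X]

/-- `C(X)` for a compact space `X`, with the constant function `1` as strong unit. -/
noncomputable def ofC [CompactSpace X] : WStar.{u} where
  carrier := C(X, ℝ)
  isOrderedModule :=
    { smul_le_smul_of_nonneg_left := fun c hc f g hfg x =>
        mul_le_mul_of_nonneg_left (hfg x) hc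
      smul_le_smul_of_nonneg_right := fun f hf c d hcd x =>
        mul_le_mul_of_nonneg_right hcd (hf x) }
  archimedean a b ha h := by
    ext x
    by_contra hne
    have h0 : 0 < a x := lt_of_le_of_ne (ha x) (Ne.symm hne)
    obtain ⟨n, hn⟩ := exists_lt_nsmul h0 (b x)
    have h1 : n • a x ≤ b x := h n x
    exact absurd h1 (not_le.mpr hn)
  unit := 1
  unit_nonneg _ := zero_le_one
  unit_strong a := by
    obtain ⟨n, hn⟩ := exists_nat_ge ‖a‖
    refine ⟨n, fun x => ?_⟩
    have h1 : |a x| ≤ n := (a.norm_coe_le_norm x).trans hn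
    simpa using h1

/-- The continuous real-valued functions on `X` with finite range, as a subspace of `C(X)`. -/
def finiteRange : Submodule ℝ C(X, ℝ) where
  carrier := {f | (Set.range f).Finite}
  zero_mem' := (Set.finite_singleton (0 : ℝ)).subset (by rintro _ ⟨x, rfl⟩; rfl)
  add_mem' {f g} hf hg := (Set.Finite.image2 (· + ·) hf hg).subset (by
    rintro _ ⟨x, rfl⟩; exact ⟨f x, ⟨x, rfl⟩, g x, ⟨x, rfl⟩, rfl⟩)
  smul_mem' c f hf := (Set.Finite.image (c * ·) hf).subset (by
    rintro _ ⟨x, rfl⟩; exact ⟨f x, ⟨x, rfl⟩, rfl⟩)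

theorem finiteRange_sup {f g : C(X, ℝ)} (hf : f ∈ finiteRange X) (hg : g ∈ finiteRange X) :
    f ⊔ g ∈ finiteRange X :=
  (Set.Finite.image2 (· ⊔ ·) hf hg).subset (by
    rintro _ ⟨x, rfl⟩; exact ⟨f x, ⟨x, rfl⟩, g x, ⟨x, rfl⟩, rfl⟩)

theorem finiteRange_inf {f g : C(X, ℝ)} (hf : f ∈ finiteRange X) (hg : g ∈ finiteRange X) :
    f ⊓ g ∈ finiteRange X :=
  (Set.Finite.image2 (· ⊓ ·) hf hg).subset (by
    rintro _ ⟨x, rfl⟩; exact ⟨f x, ⟨x, rfl⟩, g x, ⟨x, rfl⟩, rfl⟩)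

/-- The pointwise lattice operations on the functions with finite range. -/
instance : Lattice (finiteRange X) :=
  Subtype.lattice (fun _ _ hf hg => finiteRange_sup X hf hg)
    (fun _ _ hf hg => finiteRange_inf X hf hg)

/-- `F(X)`, the vector lattice of the continuous functions on `X` with finite range, with the
constant function `1` as strong unit. -/
noncomputable def ofF [CompactSpace X] : WStar.{u} where
  carrier := finiteRange X
  isOrderedAddMonoid :=
    { add_le_add_left := fun f g hfg h x => add_le_add_left (hfg x) (h.1 x) }
  isOrderedModule :=
    { smul_le_smul_of_nonneg_left := fun c hc f g hfg x =>
        mul_le_mul_of_nonneg_left (hfg x) hc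
      smul_le_smul_of_nonneg_right := fun f hf c d hcd x =>
        mul_le_mul_of_nonneg_right hcd (hf x) }
  archimedean a b ha h :=
    Subtype.ext ((ofC X).archimedean a.1 b.1 ha fun n => h n)
  unit := ⟨1, (Set.finite_singleton (1 : ℝ)).subset (by rintro _ ⟨x, rfl⟩; rfl)⟩
  unit_nonneg _ := zero_le_one
  unit_strong a := by
    obtain ⟨n, hn⟩ := (ofC X).unit_strong a.1
    exact ⟨n, hn⟩

end Functions

/-- A continuous map `τ : Y → X` induces the morphism `F(X) → C(Y)`, `f ↦ f ∘ τ`. -/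
noncomputable def compHom {X Y : Type u} [TopologicalSpace X] [CompactSpace X]
    [TopologicalSpace Y] [CompactSpace Y] (τ : C(Y, X)) : Hom (ofF X) (ofC Y) where
  toFun f := f.1.comp τ
  map_add' _ _ := rfl
  map_smul' _ _ := rfl
  map_sup' _ _ := rfl
  map_inf' _ _ := rfl
  map_unit' := rfl

end WStar

/-- The canonical continuous map `βD → αD` that extends the inclusion of the discrete space `D` in
its one-point compactification `αD`. -/
noncomputable def betaToAlpha (D : Type u) [TopologicalSpace D] [DiscreteTopology D] :
    C(StoneCech D, OnePoint D) where
  toFun := stoneCechExtend (OnePoint.continuous_coe : Continuous ((↑) : D → OnePoint D))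
  continuous_toFun := continuous_stoneCechExtend OnePoint.continuous_coe

/-! An embedding of `A` into `C(X)` is essential exactly when every proper closed subset of `X` lies
in the zero set of some nonzero element of `A` (`IsSupportDense`). For extremally disconnected `E`,
`C(E)` is injective (`exists_extension_ofC`), so essential embeddings into `C(E)` are automatically
essential completions. The poset thus consists of the support-dense subobjects of `C(E)`, ordered by
inclusion.

Suppose there is a minimum. For nonisolated `p`, `q` the functions with equal values at `p` and `q`
form an essential subobject, so every member of the minimum is constant on the nonisolated points.
On an open set without isolated points this contradicts support density, hence the isolated points
are dense. Projectivity of `E` then makes the canonical map from `βD` to `E` a homeomorphism, where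
`D` is the set of isolated points.

Conversely, every support-dense subobject contains the indicators of the isolated points. Together
with `1` these span `F(αD)`, which is itself support dense when `D` is dense, so it is the minimum.
-/

namespace WStar

/-! ### Elementary properties of morphisms -/

section Basic

variable {A B C : WStar.{u}}

theorem Hom.map_add (f : Hom A B) (x y : A) : f (x + y) = f x + f y := f.toLinearMap.map_add x y

theorem Hom.map_neg (f : Hom A B) (x : A) : f (-x) = -f x := f.toLinearMap.map_neg x

theorem Hom.map_sub (f : Hom A B) (x y : A) : f (x - y) = f x - f y := f.toLinearMap.map_sub x y

theorem Hom.map_zero (f : Hom A B) : f 0 = 0 := f.toLinearMap.map_zero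

theorem Hom.map_smul (f : Hom A B) (r : ℝ) (x : A) : f (r • x) = r • f x :=
  f.toLinearMap.map_smul r x

theorem Hom.map_sup (f : Hom A B) (x y : A) : f (x ⊔ y) = f x ⊔ f y := f.map_sup' x y

theorem Hom.map_inf (f : Hom A B) (x y : A) : f (x ⊓ y) = f x ⊓ f y := f.map_inf' x y

theorem Hom.map_unit (f : Hom A B) : f A.unit = B.unit := f.map_unit'

theorem Hom.map_abs (f : Hom A B) (x : A) : f |x| = |f x| := by
  rw [abs, abs, f.map_sup, f.map_neg]

theorem Hom.comp_apply (g : Hom B C) (f : Hom A B) (x : A) : g.comp f x = g (f x) := rfl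

@[ext]
theorem Hom.ext {f g : Hom A B} (h : ∀ x, f x = g x) : f = g := DFunLike.ext f g h

theorem Hom.monotone (f : Hom A B) : Monotone f := fun x y h => by
  rw [← sup_eq_right] at h ⊢
  rw [← f.map_sup, h]

theorem Hom.le_iff_le {f : Hom A B} (hf : Function.Injective f) {x y : A} : f x ≤ f y ↔ x ≤ y := by
  refine ⟨fun h => ?_, fun h => f.monotone h⟩
  rw [← sup_eq_right] at h ⊢
  exact hf (by rw [f.map_sup, h])

theorem Hom.injective_of_eq_zero {f : Hom A B} (h : ∀ x, f x = 0 → x = 0) :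
    Function.Injective f :=
  fun x y hxy => sub_eq_zero.1 (h _ (by rw [f.map_sub, hxy, sub_self]))

theorem exists_abs_le_smul_unit (x : A) : ∃ r : ℝ, -(r • A.unit) ≤ x ∧ x ≤ r • A.unit := by
  obtain ⟨n, hn⟩ := A.unit_strong x
  refine ⟨n, ?_, ?_⟩
  · rw [Nat.cast_smul_eq_nsmul]; exact neg_le.1 ((neg_le_abs x).trans hn)
  · rw [Nat.cast_smul_eq_nsmul]; exact (le_abs_self x).trans hn

end Basic

/-! ### Real-valued homomorphisms, Hahn–Banach, and injectivity of `C(E)` -/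

section Sublinear

/-- The monotone sublinear functionals that preserve binary suprema and real multiples of the
unit. -/
structure IsSupSublinear {A : WStar.{u}} (p : A → ℝ) : Prop where
  mono : Monotone p
  add_le : ∀ x y, p (x + y) ≤ p x + p y
  smul_le : ∀ (r : ℝ) x, 0 < r → p (r • x) ≤ r * p x
  sup_le : ∀ x y, p (x ⊔ y) ≤ max (p x) (p y)
  unit : ∀ r : ℝ, p (r • A.unit) = r

variable {A B : WStar.{u}}

namespace IsSupSublinear

theorem zero {p : A → ℝ} (hp : IsSupSublinear p) : p 0 = 0 := by
  simpa using hp.unit 0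

theorem neg_le {p : A → ℝ} (hp : IsSupSublinear p) (x : A) : -p (-x) ≤ p x := by
  have := hp.add_le x (-x)
  rw [add_neg_cancel, hp.zero] at this
  linarith

theorem neg_le_of_le {p : A → ℝ} (hp : IsSupSublinear p) {r : ℝ} {x : A}
    (h : -(r • A.unit) ≤ x) : -r ≤ p x := by
  rw [← neg_smul] at h
  exact (hp.unit (-r)).ge.trans (hp.mono h)

/-- Subadditivity and the bound on suprema each involve two values of the infimum; directedness
provides one index that serves both. The strong unit bounds the values from below. Applied to
chains, this feeds Zorn's lemma. -/
theorem iInf_of_directed {ι : Type*} [Nonempty ι] {p : ι → A → ℝ}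
    (hp : ∀ i, IsSupSublinear (p i)) (hd : ∀ i j, ∃ k, p k ≤ p i ∧ p k ≤ p j) :
    IsSupSublinear (fun x => ⨅ i, p i x) ∧ ∀ i x, ⨅ j, p j x ≤ p i x := by
  have hb : ∀ x, BddBelow (Set.range fun i => p i x) := fun x => by
    obtain ⟨r, hr, -⟩ := exists_abs_le_smul_unit x
    exact ⟨-r, by rintro _ ⟨i, rfl⟩; exact (hp i).neg_le_of_le hr⟩
  have hle : ∀ i x, ⨅ j, p j x ≤ p i x := fun i x => ciInf_le (hb x) i
  refine ⟨⟨fun x y hxy => ciInf_mono (hb x) fun i => (hp i).mono hxy, fun x y => ?_,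
    fun r x hr => ?_, fun x y => ?_, fun r => ?_⟩, hle⟩
  · refine le_ciInf_add_ciInf fun i j => ?_
    obtain ⟨k, hki, hkj⟩ := hd i j
    exact (hle k _).trans (((hp k).add_le x y).trans (add_le_add (hki x) (hkj y)))
  · rw [Real.mul_iInf_of_nonneg hr.le]
    exact ciInf_mono (hb _) fun i => (hp i).smul_le r x hr
  · refine le_of_forall_gt fun s hs => ?_
    obtain ⟨hx, hy⟩ := max_lt_iff.1 hs
    obtain ⟨i, hi⟩ := exists_lt_of_ciInf_lt hx
    obtain ⟨j, hj⟩ := exists_lt_of_ciInf_lt hy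
    obtain ⟨k, hki, hkj⟩ := hd i j
    exact (hle k _).trans_lt (((hp k).sup_le x y).trans_lt
      (max_lt ((hki x).trans_lt hi) ((hkj y).trans_lt hj)))
  · simp [(hp _).unit]

theorem exists_minimal_le {p : A → ℝ} (hp : IsSupSublinear p) :
    ∃ m, m ≤ p ∧ Minimal IsSupSublinear m := by
  refine @zorn_le_nonempty₀ (A → ℝ)ᵒᵈ _ {p : A → ℝ | IsSupSublinear p}
    (fun (c : Set (A → ℝ)) hcS hc q hq => ?_) p hp
  have : Nonempty c := ⟨⟨q, hq⟩⟩
  obtain ⟨h1, h2⟩ := iInf_of_directed (p := fun i : c => i.1) (fun i => hcS i.2) fun i j => by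
    rcases hc.total i.2 j.2 with h | h
    · exact ⟨j, h, le_rfl⟩
    · exact ⟨i, le_rfl, h⟩
  exact ⟨_, h1, fun z hz x => h2 ⟨z, hz⟩ x⟩

theorem add_smul_unit {p : A → ℝ} (hp : IsSupSublinear p) (x : A) (r : ℝ) :
    p (x + r • A.unit) = p x + r := by
  apply le_antisymm
  · simpa [hp.unit] using hp.add_le x (r • A.unit)
  · have := hp.add_le (x + r • A.unit) ((-r) • A.unit)
    rw [hp.unit, neg_smul, add_neg_cancel_right] at this
    linarith

/-- The functional `x ↦ lim p (x + t z)`, for `p z = 0`, of which one thinks as the maximum over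
the subset on which `z` attains its maximum. -/
theorem exists_le_of_eq_zero {p : A → ℝ} (hp : IsSupSublinear p) {z : A} (hz : p z = 0) :
    ∃ q, IsSupSublinear q ∧ q ≤ p ∧ q (-z) ≤ 0 := by
  have hz' : ∀ t : ℝ, 0 ≤ t → p (t • z) ≤ 0 := fun t ht => by
    rcases ht.eq_or_lt with rfl | ht
    · simp [hp.zero]
    · simpa [hz] using hp.smul_le t z ht
  have hz0 : ∀ t : ℝ, 0 ≤ t → 0 ≤ p (t • z) := fun t ht => by
    rcases ht.eq_or_lt with rfl | ht
    · simp [hp.zero]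
    · have := hp.smul_le t⁻¹ (t • z) (inv_pos.2 ht)
      rw [inv_smul_smul₀ ht.ne', hz] at this
      exact nonneg_of_mul_nonneg_right this (inv_pos.2 ht)
  -- Since `p` vanishes on nonnegative multiples of `z`, `p (x + t • z)` decreases in `t` and stays
  -- above `-p (-x)`, so the limit is an infimum.
  have hanti : ∀ s t : ℝ, s ≤ t → ∀ x, p (x + t • z) ≤ p (x + s • z) := fun s t h x => by
    have := hp.add_le (x + s • z) ((t - s) • z)
    have h2 := hz' (t - s) (sub_nonneg.2 h)
    rw [add_assoc, ← add_smul, add_sub_cancel] at this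
    linarith
  have hb : ∀ x, BddBelow (Set.range fun t : Set.Ici (0 : ℝ) => p (x + t.1 • z)) := fun x => by
    refine ⟨-p (-x), ?_⟩
    rintro _ ⟨t, rfl⟩
    have := hp.add_le (-x) (x + t.1 • z)
    have h2 := hz0 t.1 t.2
    rw [neg_add_cancel_left] at this
    simp only
    linarith
  have hle : ∀ (t : ℝ) (ht : 0 ≤ t) x, ⨅ t : Set.Ici (0 : ℝ), p (x + t.1 • z) ≤ p (x + t • z) :=
    fun t ht x => ciInf_le (hb x) ⟨t, ht⟩
  refine ⟨fun x => ⨅ t : Set.Ici (0 : ℝ), p (x + t.1 • z),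
    ⟨fun x y h => ciInf_mono (hb x) fun t => hp.mono (by gcongr), fun x y => ?_, fun r x hr => ?_,
      fun x y => ?_, fun r => ?_⟩, fun x => ?_, ?_⟩
  · refine le_ciInf_add_ciInf fun s t => ?_
    refine (hle (s.1 + t.1) (add_nonneg s.2 t.2) _).trans ?_
    rw [add_smul, add_add_add_comm]
    exact hp.add_le _ _
  · rw [Real.mul_iInf_of_nonneg hr.le]
    refine le_ciInf fun t => (hle (r * t.1) (mul_nonneg hr.le t.2) _).trans ?_
    rw [mul_smul, ← smul_add]
    exact hp.smul_le _ _ hr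
  · refine le_of_forall_gt fun s hs => ?_
    obtain ⟨hx, hy⟩ := max_lt_iff.1 hs
    obtain ⟨i, hi⟩ := exists_lt_of_ciInf_lt hx
    obtain ⟨j, hj⟩ := exists_lt_of_ciInf_lt hy
    refine (hle (max i.1 j.1) (le_max_of_le_left i.2) _).trans_lt ?_
    rw [sup_add]
    exact (hp.sup_le _ _).trans_lt (max_lt ((hanti _ _ (le_max_left _ _) x).trans_lt hi)
      ((hanti _ _ (le_max_right _ _) y).trans_lt hj))
  · have : ∀ t : Set.Ici (0 : ℝ), p (r • A.unit + t.1 • z) = r := fun t => by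
      rw [add_comm, hp.add_smul_unit, le_antisymm (hz' t.1 t.2) (hz0 t.1 t.2), zero_add]
    have : Nonempty (Set.Ici (0 : ℝ)) := ⟨⟨0, Set.self_mem_Ici⟩⟩
    simp [*]
  · simpa using hle 0 le_rfl x
  · simpa [hp.zero] using hle 1 zero_le_one (-z)

end IsSupSublinear

variable (A) in
/-- The unit-preserving vector lattice homomorphisms `A → ℝ`, with the topology of pointwise
convergence. -/
def spectrum : Set (A → ℝ) :=
  {φ | (∀ x y, φ (x + y) = φ x + φ y) ∧ (∀ (r : ℝ) x, φ (r • x) = r * φ x) ∧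
    (∀ x y, φ (x ⊔ y) = φ x ⊔ φ y) ∧ (∀ x y, φ (x ⊓ y) = φ x ⊓ φ y) ∧ φ A.unit = 1}

theorem monotone_of_mem_spectrum {φ : A → ℝ} (h : φ ∈ spectrum A) : Monotone φ := fun x y hxy => by
  rw [← sup_eq_right] at hxy ⊢
  rw [← h.2.2.1, hxy]

theorem neg_of_mem_spectrum {φ : A → ℝ} (h : φ ∈ spectrum A) (x : A) : φ (-x) = -φ x := by
  simpa using h.2.1 (-1) x

/-- Shift `y` by a multiple of the unit so that `p` vanishes there; the smaller functional of
`exists_le_of_eq_zero` must equal `p`, which gives `p (-y) = -p y`. Each one-sided inequality,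
applied also to negatives, then becomes an equality. -/
theorem mem_spectrum_of_minimal {p : A → ℝ} (hp : Minimal IsSupSublinear p) : p ∈ spectrum A := by
  have hs := hp.prop
  have hneg : ∀ y, p (-y) = -p y := fun y => by
    have hz : p (y + (-p y) • A.unit) = 0 := by rw [hs.add_smul_unit, add_neg_cancel]
    obtain ⟨q, hq, hqp, hqz⟩ := hs.exists_le_of_eq_zero hz
    have h1 := (hp.le_of_le hq hqp _).trans hqz
    rw [neg_add, neg_smul, neg_neg, hs.add_smul_unit] at h1
    have h2 := hs.neg_le y
    linarith
  have hsup : ∀ x y, p (x ⊔ y) = p x ⊔ p y := fun x y =>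
    le_antisymm (hs.sup_le x y) (sup_le (hs.mono le_sup_left) (hs.mono le_sup_right))
  have hpos : ∀ (r : ℝ) x, 0 < r → p (r • x) = r * p x := fun r x hr => by
    have h1 := hs.smul_le r x hr
    have h2 := hs.smul_le r (-x) hr
    rw [smul_neg, hneg, hneg] at h2
    linarith
  refine ⟨fun x y => ?_, fun r x => ?_, hsup, fun x y => ?_, by simpa using hs.unit 1⟩
  · have h1 := hs.add_le x y
    have h2 := hs.add_le (-x) (-y)
    rw [← neg_add, hneg, hneg, hneg] at h2
    linarith
  · rcases lt_trichotomy r 0 with hr | rfl | hr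
    · have := hpos (-r) x (neg_pos.2 hr)
      rw [neg_smul, hneg] at this
      linarith
    · simp [hs.zero]
    · exact hpos r x hr
  · have := hsup (-x) (-y)
    rw [← neg_inf, hneg, hneg, hneg, ← neg_inf] at this
    exact neg_injective this

/-- The Hahn–Banach theorem for real-valued homomorphisms. -/
theorem exists_extension {f : Hom A B} (hf : Function.Injective f) {φ : A → ℝ}
    (hφ : φ ∈ spectrum A) : ∃ ψ ∈ spectrum B, ∀ a, ψ (f a) = φ a := by
  -- The infimum of `S b` is the upper envelope of `φ`. A minimal functional below it is a
  -- homomorphism bounded by `φ` on `A`, hence equal to `φ` there, as negation reverses the bound.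
  let S : B → Set ℝ := fun b => φ '' {a | b ≤ f a}
  have hunit : ∀ r : ℝ, φ (r • A.unit) = r := fun r => by rw [hφ.2.1, hφ.2.2.2.2, mul_one]
  have hfunit : ∀ r : ℝ, f (r • A.unit) = r • B.unit := fun r => by rw [f.map_smul, f.map_unit]
  have hne : ∀ b, (S b).Nonempty := fun b => by
    obtain ⟨r, -, hr⟩ := exists_abs_le_smul_unit b
    exact ⟨_, r • A.unit, by simpa [hfunit] using hr, rfl⟩
  have hb : ∀ b, BddBelow (S b) := fun b => by
    obtain ⟨r, hr, -⟩ := exists_abs_le_smul_unit b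
    refine ⟨-r, ?_⟩
    rintro _ ⟨a, ha, rfl⟩
    have : (-r) • A.unit ≤ a := (Hom.le_iff_le hf).1 (by
      rw [hfunit, neg_smul]; exact hr.trans ha)
    exact (hunit (-r)).ge.trans (monotone_of_mem_spectrum hφ this)
  have hle : ∀ {a b}, b ≤ f a → sInf (S b) ≤ φ a := fun {a b} h => csInf_le (hb b) ⟨a, h, rfl⟩
  have hlt : ∀ {b r}, sInf (S b) < r → ∃ a, b ≤ f a ∧ φ a < r := fun {b r} h => by
    obtain ⟨_, ⟨a, ha, rfl⟩, har⟩ := exists_lt_of_csInf_lt (hne b) h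
    exact ⟨a, ha, har⟩
  have hS : IsSupSublinear fun b => sInf (S b) := by
    refine ⟨fun x y hxy => le_csInf (hne y) ?_, fun x y => ?_, fun r x hr => ?_, fun x y => ?_,
      fun r => le_antisymm ?_ (le_csInf (hne _) ?_)⟩
    · rintro _ ⟨a, ha, rfl⟩
      exact hle (hxy.trans ha)
    · refine le_of_forall_pos_lt_add fun ε hε => ?_
      obtain ⟨a, ha, ha'⟩ := hlt (lt_add_of_pos_right (sInf (S x)) (half_pos hε))
      obtain ⟨c, hc, hc'⟩ := hlt (lt_add_of_pos_right (sInf (S y)) (half_pos hε))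
      have : sInf (S (x + y)) ≤ φ (a + c) := hle (by rw [f.map_add]; exact add_le_add ha hc)
      rw [hφ.1] at this
      linarith
    · rw [← div_le_iff₀' hr]
      refine le_csInf (hne x) ?_
      rintro _ ⟨a, ha, rfl⟩
      rw [div_le_iff₀' hr, ← hφ.2.1]
      exact hle (by rw [f.map_smul]; exact smul_le_smul_of_nonneg_left ha hr.le)
    · refine le_of_forall_gt fun s hs => ?_
      obtain ⟨hx, hy⟩ := max_lt_iff.1 hs
      obtain ⟨a, ha, ha'⟩ := hlt hx
      obtain ⟨c, hc, hc'⟩ := hlt hy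
      refine (hle (a := a ⊔ c) (by rw [f.map_sup]; exact sup_le_sup ha hc)).trans_lt ?_
      rw [hφ.2.2.1]
      exact max_lt ha' hc'
    · simpa [hunit] using hle (hfunit r).ge
    · rintro _ ⟨a, ha, rfl⟩
      have : r • A.unit ≤ a := (Hom.le_iff_le hf).1 (by rw [hfunit]; exact ha)
      simpa [hunit] using monotone_of_mem_spectrum hφ this
  obtain ⟨ψ, hψ, hmin⟩ := hS.exists_minimal_le
  have hψs := mem_spectrum_of_minimal hmin
  have h1 : ∀ a, ψ (f a) ≤ φ a := fun a => (hψ (f a)).trans (hle le_rfl)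
  refine ⟨ψ, hψs, fun a => le_antisymm (h1 a) ?_⟩
  have := h1 (-a)
  rw [f.map_neg, neg_of_mem_spectrum hψs, neg_of_mem_spectrum hφ] at this
  linarith

instance (A : WStar.{u}) : CompactSpace (spectrum A) := by
  rw [← isCompact_iff_compactSpace]
  choose r hr using fun x : A => exists_abs_le_smul_unit x
  refine (isCompact_univ_pi fun x => isCompact_Icc (a := -r x) (b := r x)).of_isClosed_subset
    ?_ ?_
  · simp only [spectrum, Set.ofPred_and, Set.ofPred_forall]
    refine IsClosed.inter ?_ (IsClosed.inter ?_ (IsClosed.inter ?_ (IsClosed.inter ?_ ?_)))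
    · exact isClosed_iInter fun x => isClosed_iInter fun y =>
        isClosed_eq (by fun_prop) (by fun_prop)
    · exact isClosed_iInter fun x => isClosed_iInter fun y =>
        isClosed_eq (by fun_prop) (by fun_prop)
    · exact isClosed_iInter fun x => isClosed_iInter fun y =>
        isClosed_eq (by fun_prop) ((continuous_apply x).sup (continuous_apply y))
    · exact isClosed_iInter fun x => isClosed_iInter fun y =>
        isClosed_eq (by fun_prop) ((continuous_apply x).inf (continuous_apply y))
    · exact isClosed_eq (by fun_prop) (by fun_prop)
  · intro φ hφ x _
    have hunit : ∀ r : ℝ, φ (r • A.unit) = r := fun r => by rw [hφ.2.1, hφ.2.2.2.2, mul_one]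
    have h1 := monotone_of_mem_spectrum hφ (hr x).1
    have h2 := monotone_of_mem_spectrum hφ (hr x).2
    rw [neg_of_mem_spectrum hφ, hunit] at h1
    rw [hunit] at h2
    exact ⟨h1, h2⟩

/-- The value of the function `f a` at a point. -/
noncomputable def Hom.value {X : Type u} [TopologicalSpace X] [CompactSpace X] (f : Hom A (ofC X)) (a : A)
    (x : X) : ℝ :=
  (show C(X, ℝ) from f a) x

section Value

variable {X : Type u} [TopologicalSpace X] [CompactSpace X] (f : Hom A (ofC X))

theorem Hom.continuous_value (a : A) : Continuous (f.value a) :=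
  ContinuousMap.continuous (show C(X, ℝ) from f a)

theorem Hom.ext_value {a b : ofC X}
    (h : ∀ x, (show C(X, ℝ) from a) x = (show C(X, ℝ) from b) x) : a = b :=
  ContinuousMap.ext h

theorem Hom.value_add (a b : A) (x : X) : f.value (a + b) x = f.value a x + f.value b x :=
  congrArg (fun k : C(X, ℝ) => k x) (f.map_add a b)

theorem Hom.value_smul (r : ℝ) (a : A) (x : X) : f.value (r • a) x = r * f.value a x :=
  congrArg (fun k : C(X, ℝ) => k x) (f.map_smul r a)

theorem Hom.value_sup (a b : A) (x : X) : f.value (a ⊔ b) x = f.value a x ⊔ f.value b x :=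
  congrArg (fun k : C(X, ℝ) => k x) (f.map_sup a b)

theorem Hom.value_inf (a b : A) (x : X) : f.value (a ⊓ b) x = f.value a x ⊓ f.value b x :=
  congrArg (fun k : C(X, ℝ) => k x) (f.map_inf a b)

theorem Hom.value_unit (x : X) : f.value A.unit x = 1 :=
  congrArg (fun k : C(X, ℝ) => k x) f.map_unit

theorem Hom.value_zero (x : X) : f.value 0 x = 0 :=
  congrArg (fun k : C(X, ℝ) => k x) f.map_zero

theorem Hom.value_neg (a : A) (x : X) : f.value (-a) x = -f.value a x :=
  congrArg (fun k : C(X, ℝ) => k x) (f.map_neg a)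

theorem Hom.value_abs (a : A) (x : X) : f.value |a| x = |f.value a x| := by
  rw [abs, abs, f.value_sup, f.value_neg]

variable {f}

theorem Hom.le_of_value_le (hf : Function.Injective f) {a b : A}
    (h : ∀ x, f.value a x ≤ f.value b x) : a ≤ b :=
  (Hom.le_iff_le hf).1 (show (show C(X, ℝ) from f a) ≤ (show C(X, ℝ) from f b) from h)

theorem Hom.exists_value_ne_zero (hf : Function.Injective f) {a : A} (ha : a ≠ 0) :
    ∃ x, f.value a x ≠ 0 := by
  by_contra! h
  exact ha (hf ((Hom.ext_value h).trans f.map_zero.symm))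

end Value

/-- `C(E)` is injective when `E` is extremally disconnected. -/
theorem exists_extension_ofC {E : Type u} [TopologicalSpace E] [CompactSpace E] [T2Space E]
    [ExtremallyDisconnected E] {f : Hom A B} (hf : Function.Injective f) (g : Hom A (ofC E)) :
    ∃ h : Hom B (ofC E), g = h.comp f := by
  -- Evaluation sends `E` to the spectrum of `A`, and restriction `ρ` between the spectra is onto by
  -- Hahn–Banach. A lift of `α` through `ρ`, by projectivity of `E`, is the extension sought.
  let α : E → spectrum A := fun e => ⟨fun a => g.value a e, fun x y => g.value_add x y e,
    fun r x => g.value_smul r x e, fun x y => g.value_sup x y e, fun x y => g.value_inf x y e,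
    g.value_unit e⟩
  have hα : Continuous α := Continuous.subtype_mk (continuous_pi g.continuous_value) _
  let ρ : spectrum B → spectrum A := fun ψ => ⟨fun a => ψ.1 (f a),
    fun x y => by simp only [f.map_add, ψ.2.1], fun r x => by simp only [f.map_smul, ψ.2.2.1],
    fun x y => by simp only [f.map_sup, ψ.2.2.2.1],
    fun x y => by simp only [f.map_inf, ψ.2.2.2.2.1], by simp only [f.map_unit, ψ.2.2.2.2.2]⟩
  have hρ : Continuous ρ :=
    Continuous.subtype_mk (f := fun ψ : spectrum B => fun a => ψ.1 (f a))
      (continuous_pi fun a => (continuous_apply (f a)).comp continuous_subtype_val) _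
  have hρs : Function.Surjective ρ := fun φ => by
    obtain ⟨ψ, hψ, h⟩ := exists_extension hf φ.2
    exact ⟨⟨ψ, hψ⟩, Subtype.ext (funext h)⟩
  obtain ⟨β, hβ, hβα⟩ := CompactT2.ExtremallyDisconnected.projective (A := E) hα hρ hρs
  refine ⟨⟨⟨⟨fun b => (⟨fun e => (β e).1 b, (continuous_apply b).comp
    (continuous_subtype_val.comp hβ)⟩ : C(E, ℝ)), ?_⟩, ?_⟩, ?_, ?_, ?_⟩, ?_⟩
  · exact fun x y => ContinuousMap.ext fun e => (β e).2.1 x y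
  · exact fun r x => ContinuousMap.ext fun e => (β e).2.2.1 r x
  · exact fun x y => ContinuousMap.ext fun e => (β e).2.2.2.1 x y
  · exact fun x y => ContinuousMap.ext fun e => (β e).2.2.2.2.1 x y
  · exact ContinuousMap.ext fun e => (β e).2.2.2.2.2
  · refine Hom.ext fun a => ContinuousMap.ext fun e => ?_
    exact (congrFun (congrArg Subtype.val (congrFun hβα e)) a).symm

theorem Hom.IsEssential.isEssentialCompletion {E : Type u} [TopologicalSpace E] [CompactSpace E]
    [T2Space E] [ExtremallyDisconnected E] {f : Hom A (ofC E)} (hf : f.IsEssential) :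
    f.IsEssentialCompletion :=
  ⟨hf, fun _ _ hf' => exists_extension_ofC hf'.1 f⟩

end Sublinear

end WStar

namespace WStar

/-! ### Essential embeddings, support density and nonisolated points -/

section Essential

variable {A B C : WStar.{u}} {X : Type u} [TopologicalSpace X] [CompactSpace X]

/-- Every proper closed subset of `X` is contained in the zero set of the image of a nonzero
element of `A`. -/
def Hom.IsSupportDense (f : Hom A (ofC X)) : Prop :=
  ∀ F : Set X, IsClosed F → F ≠ Set.univ → ∃ a, a ≠ 0 ∧ ∀ x ∈ F, f.value a x = 0

/-- The restriction of continuous functions to a closed subset. -/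
noncomputable def restrictHom (F : Set X) [CompactSpace F] : Hom (ofC X) (ofC F) where
  toFun f := (show C(X, ℝ) from f).restrict F
  map_add' _ _ := rfl
  map_smul' _ _ := rfl
  map_sup' _ _ := rfl
  map_inf' _ _ := rfl
  map_unit' := rfl

theorem exists_continuous_ne_zero [T2Space X] {F : Set X} (hF : IsClosed F) {x : X} (hx : x ∉ F) :
    ∃ k : C(X, ℝ), k x ≠ 0 ∧ ∀ y ∈ F, k y = 0 := by
  obtain ⟨k, h0, h1, -⟩ := exists_continuous_zero_one_of_isClosed hF
    (isClosed_singleton (x := x)) (Set.disjoint_singleton_right.2 hx)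
  exact ⟨k, by simp [h1 rfl], h0⟩

/-- Otherwise restriction to `F` is injective on `A`, hence by essentiality on all of `C(X)`; a
Urysohn function vanishing on `F` refutes this. -/
theorem Hom.IsEssential.isSupportDense [T2Space X] {f : Hom A (ofC X)} (hf : f.IsEssential) :
    f.IsSupportDense := by
  intro F hF hFu
  have : CompactSpace F := isCompact_iff_compactSpace.1 hF.isCompact
  by_contra! h
  have hinj := hf.2 (ofC F) (restrictHom F) (Hom.injective_of_eq_zero fun a ha => by
    by_contra hne
    obtain ⟨x, hx, hxa⟩ := h a hne
    exact hxa (congrArg (fun k : C(F, ℝ) => k ⟨x, hx⟩) ha))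
  obtain ⟨x, hx⟩ := (Set.ne_univ_iff_exists_notMem F).1 hFu
  obtain ⟨k, hkx, hkF⟩ := exists_continuous_ne_zero hF hx
  have hk : k = (0 : C(X, ℝ)) := hinj (show restrictHom F k = restrictHom F (0 : C(X, ℝ)) from
    ContinuousMap.ext fun y => hkF y.1 y.2)
  exact hkx (by rw [hk]; rfl)

theorem eq_zero_of_abs_le_smul_unit {c : C}
    (h : ∀ ε : ℝ, 0 < ε → |c| ≤ ε • C.unit) : c = 0 := by
  have h0 : |c| = 0 := C.archimedean |c| C.unit (abs_nonneg c) fun n => by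
    rcases n.eq_zero_or_pos with rfl | hn
    · simpa using C.unit_nonneg
    · have hn' : (0 : ℝ) < n := Nat.cast_pos.2 hn
      have := smul_le_smul_of_nonneg_left (h (n : ℝ)⁻¹ (inv_pos.2 hn')) hn'.le
      rwa [smul_inv_smul₀ hn'.ne', Nat.cast_smul_eq_nsmul] at this
  exact le_antisymm (h0 ▸ le_abs_self c) (neg_nonpos.1 (h0 ▸ neg_le_abs c))

/-- Let `F` be the common zero set of the kernel of `g`. If the kernel is nonzero, `F` is proper,
and some nonzero `a` vanishes on `F`. By compactness `|a| ≤ ε + k` with `k` in the kernel, so `g`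
sends `a` to an infinitesimal, hence to zero. The intermediate `B` is needed to compare two
subobjects of `C(X)`. -/
theorem Hom.IsSupportDense.isEssential_of_comp {i : Hom A B} {j : Hom B (ofC X)}
    (hj : Function.Injective j) (hi : Function.Injective i) (h : (j.comp i).IsSupportDense) :
    i.IsEssential := by
  refine ⟨hi, fun C g hgi => Hom.injective_of_eq_zero fun b hb => ?_⟩
  by_contra hne
  obtain ⟨x, hx⟩ := Hom.exists_value_ne_zero hj hne
  let F : Set X := {x | ∀ k : B, g k = 0 → j.value k x = 0}
  have hF : IsClosed F := by
    simp only [F, Set.ofPred_forall]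
    exact isClosed_iInter fun k => isClosed_iInter fun _ =>
      isClosed_eq (j.continuous_value k) continuous_const
  have hFu : F ≠ Set.univ := fun hu => hx ((hu ▸ Set.mem_univ x : x ∈ F) b hb)
  obtain ⟨a, ha0, ha⟩ := h F hF hFu
  refine ha0 (hgi ?_)
  rw [Hom.map_zero, Hom.comp_apply]
  refine eq_zero_of_abs_le_smul_unit fun ε hε => ?_
  obtain ⟨k, hgk, -, hk⟩ : ∃ k : B, g k = 0 ∧ 0 ≤ k ∧
      ∀ x ∈ (Set.univ : Set X), |j.value (i a) x| ≤ ε + j.value k x := by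
    have hnn : ∀ k : B, 0 ≤ k → ∀ x, 0 ≤ j.value k x := fun k hk x => by
      have : (0 : C(X, ℝ)) ≤ j k := by
        have := j.monotone hk
        rwa [j.map_zero] at this
      exact this x
    -- Near a point of `F`, `k = 0` works by continuity; near any other point, a large multiple of
    -- some `|k|` dominates. Finitely many such `k` are added.
    refine isCompact_univ.induction_on (p := fun s => ∃ k : B, g k = 0 ∧ 0 ≤ k ∧
      ∀ x ∈ s, |j.value (i a) x| ≤ ε + j.value k x) ⟨0, g.map_zero, le_rfl, by simp⟩
      (fun s t hst ⟨k, h1, h2, h3⟩ => ⟨k, h1, h2, fun x hx => h3 x (hst hx)⟩)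
      (fun s t ⟨k, h1, h2, h3⟩ ⟨l, h4, h5, h6⟩ => ⟨k + l, by rw [g.map_add, h1, h4, add_zero],
        add_nonneg h2 h5, fun x hx => ?_⟩) fun x _ => ?_
    · rw [j.value_add]
      rcases hx with hx | hx
      · linarith [h3 x hx, hnn l h5 x]
      · linarith [h6 x hx, hnn k h2 x]
    · have hca : Continuous fun y => |j.value (i a) y| := (j.continuous_value _).abs
      by_cases hxF : x ∈ F
      · have h0 : |j.value (i a) x| < ε := by
          rw [show j.value (i a) x = 0 from ha x hxF]; simpa using hε
        refine ⟨{y | |j.value (i a) y| < ε}, mem_nhdsWithin_of_mem_nhds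
          ((isOpen_lt hca continuous_const).mem_nhds h0), 0, g.map_zero, le_rfl, fun y hy => ?_⟩
        rw [j.value_zero, add_zero]
        exact le_of_lt hy
      · obtain ⟨k, hgk, hk⟩ : ∃ k : B, g k = 0 ∧ j.value k x ≠ 0 := by
          simpa [F] using hxF
        obtain ⟨n, hn⟩ := exists_nat_gt (|j.value (i a) x| / |j.value k x|)
        rw [div_lt_iff₀ (abs_pos.2 hk)] at hn
        have hval : ∀ y, j.value ((n : ℝ) • |k|) y = n * |j.value k y| := fun y => by
          rw [j.value_smul, j.value_abs]
        refine ⟨{y | |j.value (i a) y| < n * |j.value k y|}, mem_nhdsWithin_of_mem_nhds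
          ((isOpen_lt hca (continuous_const.mul (j.continuous_value k).abs)).mem_nhds hn),
          (n : ℝ) • |k|, ?_, smul_nonneg n.cast_nonneg (abs_nonneg k), fun y hy => ?_⟩
        · rw [g.map_smul, g.map_abs, hgk, abs_zero, smul_zero]
        · rw [hval]
          exact (le_of_lt hy).trans (le_add_of_nonneg_left hε.le)
  have hle : |i a| ≤ ε • B.unit + k := Hom.le_of_value_le hj fun x => by
    rw [j.value_abs, j.value_add, j.value_smul, j.value_unit, mul_one]
    exact hk x trivial
  have := g.monotone hle
  rwa [g.map_abs, g.map_add, g.map_smul, g.map_unit, hgk, add_zero] at this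

theorem Hom.IsSupportDense.isEssential {f : Hom A (ofC X)} (h : f.IsSupportDense)
    (hf : Function.Injective f) : f.IsEssential :=
  Hom.IsSupportDense.isEssential_of_comp (j := Hom.id (ofC X)) Function.injective_id hf h

/-- Comparison in `EssCompletedBy` is comparison of the images in `C(X)`. -/
theorem EssCompletedBy.le_of_range_subset [T2Space X] {p q : EssCompletedBy (ofC X)}
    (h : ∀ a, ∃ b, q.emb b = p.emb a) : p ≤ q := by
  choose i hi using h
  have hq := q.isEssentialCompletion.1.1
  let f : Hom p.obj q.obj :=
    { toFun := i
      map_add' := fun x y => hq (by rw [q.emb.map_add, hi, hi, hi, p.emb.map_add])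
      map_smul' := fun r x => hq (by simp only [q.emb.map_smul, hi, p.emb.map_smul, RingHom.id_apply])
      map_sup' := fun x y => hq (by simp only [q.emb.map_sup, hi, p.emb.map_sup])
      map_inf' := fun x y => hq (by simp only [q.emb.map_inf, hi, p.emb.map_inf])
      map_unit' := hq (by simp only [hi, q.emb.map_unit, p.emb.map_unit]) }
  have hcomp : p.emb = q.emb.comp f := Hom.ext fun a => (hi a).symm
  refine ⟨f, ?_, hcomp⟩
  have hp := p.isEssentialCompletion.1
  refine Hom.IsSupportDense.isEssential_of_comp hq (fun x y hxy => hp.1 ?_)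
    (hcomp ▸ hp.isSupportDense)
  rw [hcomp, Hom.comp_apply, Hom.comp_apply, hxy]

/-- The continuous functions that take the same value at two given points. -/
noncomputable def ofCGlue (p q : X) : WStar.{u} :=
  let S : Submodule ℝ C(X, ℝ) :=
    { carrier := {f | f p = f q}
      zero_mem' := rfl
      add_mem' := fun hf hg => congrArg₂ (· + ·) hf hg
      smul_mem' := fun c _ hf => congrArg (c * ·) hf }
  letI : Lattice S := Subtype.lattice (fun _ _ hf hg => congrArg₂ (· ⊔ ·) hf hg)
    (fun _ _ hf hg => congrArg₂ (· ⊓ ·) hf hg)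
  { carrier := S
    isOrderedAddMonoid :=
      { add_le_add_left := fun _ _ hfg h x => add_le_add_left (hfg x) (h.1 x) }
    isOrderedModule :=
      { smul_le_smul_of_nonneg_left := fun _ hc _ _ hfg x =>
          mul_le_mul_of_nonneg_left (hfg x) hc
        smul_le_smul_of_nonneg_right := fun _ hf _ _ hcd x =>
          mul_le_mul_of_nonneg_right hcd (hf x) }
    archimedean := fun a b ha h => Subtype.ext ((ofC X).archimedean a.1 b.1 ha fun n => h n)
    unit := ⟨1, rfl⟩
    unit_nonneg := fun _ => zero_le_one
    unit_strong := fun a => (ofC X).unit_strong a.1 }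

/-- The inclusion of `ofCGlue p q` in `C(X)`. -/
noncomputable def ofCGlueHom (p q : X) : Hom (ofCGlue p q) (ofC X) where
  toFun f := f.1
  map_add' _ _ := rfl
  map_smul' _ _ := rfl
  map_sup' _ _ := rfl
  map_inf' _ _ := rfl
  map_unit' := rfl

/-- No nonempty open set lies inside `{p, q}`, so a function can be supported off `F`, `p` and `q`;
it vanishes at both points and so belongs to the subobject. -/
theorem ofCGlueHom_isEssential [T2Space X] {p q : X} (hp : ¬ IsOpen {p}) (hq : ¬ IsOpen {q}) :
    (ofCGlueHom p q).IsEssential := by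
  refine Hom.IsSupportDense.isEssential (fun F hF hFu => ?_) fun x y h => Subtype.ext h
  obtain ⟨x, hxF, hxp, hxq⟩ : ∃ x, x ∉ F ∧ x ≠ p ∧ x ≠ q := by
    by_contra! h
    obtain ⟨x, hx⟩ := (Set.ne_univ_iff_exists_notMem F).1 hFu
    by_cases hpF : p ∈ F
    · refine hq ?_
      convert hF.isOpen_compl using 1
      have hall : ∀ y, y ∉ F → y = q := fun y hy => h y hy fun e => hy (e ▸ hpF)
      refine Set.Subset.antisymm ?_ hall
      rintro _ rfl
      exact hall x hx ▸ hx
    · refine hp ?_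
      convert hF.isOpen_compl.inter (isOpen_compl_singleton (x := q)) using 1
      by_cases hpq : p = q
      · subst hpq
        exact absurd (by
          convert hF.isOpen_compl using 1
          exact Set.Subset.antisymm (by rintro _ rfl; exact hpF)
            fun y hy => by_contra fun hyp => hyp (h y hy hyp)) hp
      · refine Set.Subset.antisymm ?_ fun y hy => by_contra fun hyp => hy.2 (h y hy.1 hyp)
        rintro _ rfl
        exact ⟨hpF, hpq⟩
  obtain ⟨k, hkx, hk⟩ := exists_continuous_ne_zero (F := F ∪ {p, q}) (x := x)
    (hF.union (Set.toFinite _).isClosed) (by simp [hxF, hxp, hxq])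
  refine ⟨⟨k, (hk p (by simp)).trans (hk q (by simp)).symm⟩, fun h0 => hkx ?_,
    fun y hy => hk y (Or.inl hy)⟩
  exact congrArg (fun f : C(X, ℝ) => f x) (congrArg Subtype.val h0)

/-- If there is a least element, the isolated points are dense. -/
theorem dense_isolated_of_isBot [T2Space X] [ExtremallyDisconnected X]
    {m : EssCompletedBy (ofC X)} (hm : ∀ p, m ≤ p) : Dense {x : X | IsOpen {x}} := by
  have hconst : ∀ a p q, ¬ IsOpen {p} → ¬ IsOpen {q} → m.emb.value a p = m.emb.value a q := by
    intro a p q hp hq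
    obtain ⟨f, -, hf⟩ := hm ⟨ofCGlue p q, ofCGlueHom p q,
      (ofCGlueHom_isEssential hp hq).isEssentialCompletion⟩
    rw [hf]
    exact (f a).2
  have hd := m.isEssentialCompletion.1.isSupportDense
  rw [dense_iff_inter_open]
  intro U hU ⟨x, hx⟩
  by_contra hne
  have hni : ∀ y ∈ U, ¬ IsOpen {y} := fun y hy h => hne ⟨y, hy, h⟩
  obtain ⟨y, hy, hyx⟩ : ∃ y ∈ U, y ≠ x := by
    by_contra! h
    exact hni x hx (by
      convert hU using 1
      exact Set.Subset.antisymm (by rintro _ rfl; exact hx) h)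
  -- Removing `x` from `U` forces `a x = 0`, while `a` is nonzero at some other point of `U`;
  -- constancy on nonisolated points forbids this.
  obtain ⟨a, ha0, ha⟩ := hd (U \ {x})ᶜ (hU.sdiff isClosed_singleton).isClosed_compl
    fun h => (h ▸ Set.mem_univ y : y ∈ (U \ {x})ᶜ) ⟨hy, hyx⟩
  obtain ⟨z, hz⟩ := Hom.exists_value_ne_zero m.isEssentialCompletion.1.1 ha0
  have hzU : z ∈ U := by_contra fun h => hz (ha z fun h' => h h'.1)
  refine hz ((hconst a z x (hni z hzU) (hni x hx)).trans (ha x fun h => h.2 rfl))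

end Essential

end WStar

/-! ### Isolated points, `βD` and `αD` -/

/-- The fibre over the isolated point `g d`, with `stoneCechUnit d` removed, is open; if nonempty it
would meet the dense image of `D`, against injectivity of `g`. -/
theorem eq_stoneCechUnit_of_stoneCechExtend_eq {D Y : Type*} [TopologicalSpace D]
    [TopologicalSpace Y] [CompactSpace Y] [T2Space Y] {g : D → Y} (hg : Continuous g)
    (hinj : Function.Injective g) {d : D} (hd : IsOpen {g d}) {b : StoneCech D}
    (hb : stoneCechExtend hg b = g d) : b = stoneCechUnit d := by
  by_contra hne
  have hU : IsOpen (stoneCechExtend hg ⁻¹' {g d} \ {stoneCechUnit d}) :=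
    (hd.preimage (continuous_stoneCechExtend hg)).sdiff isClosed_singleton
  obtain ⟨d', hd'⟩ := denseRange_stoneCechUnit.exists_mem_open hU ⟨b, hb, hne⟩
  refine hd'.2 (congrArg stoneCechUnit (hinj ?_))
  exact (stoneCechExtend_stoneCechUnit hg d').symm.trans hd'.1

/-- A compact extremally disconnected space with a dense set of isolated points is the
Čech–Stone compactification of that set. -/
theorem nonempty_homeomorph_stoneCech_of_dense_isolated {E : Type u} [TopologicalSpace E]
    [CompactSpace E] [T2Space E] [ExtremallyDisconnected E] (h : Dense {x : E | IsOpen {x}}) :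
    DiscreteTopology {x : E | IsOpen {x}} ∧ Nonempty (E ≃ₜ StoneCech {x : E | IsOpen {x}}) := by
  set D : Set E := {x : E | IsOpen {x}}
  have hD : DiscreteTopology D := discreteTopology_iff_forall_isOpen.2 fun s => by
    rw [← Set.biUnion_of_singleton s]
    refine isOpen_biUnion fun x _ => ?_
    convert (show IsOpen {x.1} from x.2).preimage continuous_subtype_val
    ext; simp [Subtype.ext_iff]
  refine ⟨hD, ?_⟩
  let π : StoneCech D → E := stoneCechExtend (continuous_subtype_val : Continuous ((↑) : D → E))
  have hπ : Continuous π := continuous_stoneCechExtend _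
  have hπD : ∀ d : D, π (stoneCechUnit d) = d := stoneCechExtend_stoneCechUnit _
  have hπs : Function.Surjective π := by
    rw [← Set.range_eq_univ, ← (isCompact_range hπ).isClosed.closure_eq, ← dense_iff_closure_eq]
    exact h.mono fun x hx => ⟨_, hπD ⟨x, hx⟩⟩
  obtain ⟨s, hs, hsπ⟩ := CompactT2.ExtremallyDisconnected.projective (A := E)
    (continuous_id) hπ hπs
  have hsπ' : ∀ x, π (s x) = x := congrFun hsπ
  -- The section `s` can only send an isolated point to its unique preimage, so both maps agree on
  -- the dense set `D`.
  have hsd : s ∘ π = id := denseRange_stoneCechUnit.equalizer (hs.comp hπ) continuous_id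
    (funext fun d =>
      eq_stoneCechUnit_of_stoneCechExtend_eq _ Subtype.val_injective d.2
        ((hsπ' _).trans (hπD d)))
  exact ⟨⟨⟨s, π, hsπ', congrFun hsd⟩, hs, hπ⟩⟩

theorem OnePoint.isOpen_singleton_coe {D : Type*} [TopologicalSpace D] [DiscreteTopology D]
    (d : D) : IsOpen {(d : OnePoint D)} := by
  simpa using OnePoint.isOpenEmbedding_coe.isOpenMap {d} (isOpen_discrete _)

/-- The indicator function of an isolated point of `αD`. -/
noncomputable def OnePoint.pointIndicator {D : Type*} [TopologicalSpace D] [DiscreteTopology D]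
    (d : D) : C(OnePoint D, ℝ) where
  toFun := Set.indicator {(d : OnePoint D)} 1
  continuous_toFun := by
    have h : IsClopen {(d : OnePoint D)} := ⟨isClosed_singleton, isOpen_singleton_coe d⟩
    exact continuous_one.indicator (by simp [h.frontier_eq])

/-- With finite range, the set where `f` differs from its value at infinity is closed and misses
infinity, so it is compact in the discrete space `D`. -/
theorem OnePoint.finite_ne_infty {D : Type*} [TopologicalSpace D] [DiscreteTopology D]
    {f : C(OnePoint D, ℝ)} (hf : (Set.range f).Finite) :
    {d : D | f d ≠ f OnePoint.infty}.Finite := by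
  have hcl : IsClosed (f ⁻¹' (Set.range f \ {f OnePoint.infty})) :=
    (hf.sdiff.isClosed).preimage f.continuous
  have heq : ((↑) : D → OnePoint D) '' {d : D | f d ≠ f OnePoint.infty} =
      f ⁻¹' (Set.range f \ {f OnePoint.infty}) := by
    ext x
    induction x using OnePoint.rec <;> simp
  rw [← heq, OnePoint.isClosed_image_coe] at hcl
  exact hcl.2.finite_of_discrete

namespace WStar

theorem Hom.value_sum {A : WStar.{u}} {X : Type u} [TopologicalSpace X] [CompactSpace X]
    (f : Hom A (ofC X)) {ι : Type*} (s : Finset ι) (a : ι → A) (x : X) :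
    f.value (∑ i ∈ s, a i) x = ∑ i ∈ s, f.value (a i) x :=
  map_sum (AddMonoidHom.mk' (fun a => f.value a x) fun a b => f.value_add a b x) a s

/-! ### `F(αD)` inside every essential subobject of `C(E)` -/

section PointDetection

variable {E D : Type u} [TopologicalSpace E] [CompactSpace E] [TopologicalSpace D]
  [DiscreteTopology D] {t : C(E, OnePoint D)} {ι : D → E}

/-- The indicator of `d` pulls back to that of `ι d`, giving support density. Noncompactness makes
`D` dense in `αD`, whence injectivity. -/
theorem compHom_isEssential [T2Space E] [NoncompactSpace D] (hι : DenseRange ι)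
    (ht : ∀ e (d : D), t e = (d : OnePoint D) ↔ e = ι d) : (compHom t).IsEssential := by
  refine Hom.IsSupportDense.isEssential (fun F hF hFu => ?_) ?_
  · obtain ⟨x, hx⟩ := (Set.ne_univ_iff_exists_notMem F).1 hFu
    obtain ⟨d, hd⟩ := hι.exists_mem_open hF.isOpen_compl ⟨x, hx⟩
    refine ⟨⟨OnePoint.pointIndicator d, (Set.toFinite {(0 : ℝ), 1}).subset ?_⟩, fun h => ?_,
      fun e he => ?_⟩
    · rintro _ ⟨x, rfl⟩
      exact (Set.indicator_eq_zero_or_self {(d : OnePoint D)} 1 x).imp id id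
    · have : OnePoint.pointIndicator d (d : OnePoint D) = 0 :=
        congrArg (fun f : C(OnePoint D, ℝ) => f d) (congrArg Subtype.val h)
      simp [OnePoint.pointIndicator] at this
    · refine Set.indicator_of_notMem (fun h => ?_) _
      exact hd ((ht e d).1 h ▸ he)
  · refine Hom.injective_of_eq_zero fun f hf => Subtype.ext (ContinuousMap.coe_injective ?_)
    refine OnePoint.denseRange_coe.equalizer f.1.continuous continuous_const (funext fun d => ?_)
    have h := congrArg (fun k : C(E, ℝ) => k (ι d)) hf
    change f.1 (t (ι d)) = 0 at h
    rwa [(ht (ι d) d).2 rfl] at h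

/-- Support density for the complement of the isolated point `ι d` yields a multiple of its
indicator. A function in `F(αD)` is its value at infinity plus a finite combination of such
indicators. -/
theorem exists_emb_eq_compHom [T2Space E] (hι : DenseRange ι)
    (ht : ∀ e (d : D), t e = (d : OnePoint D) ↔ e = ι d) (p : EssCompletedBy (ofC E))
    (f : ofF (OnePoint D)) : ∃ b, p.emb b = compHom t f := by
  classical
  have hinj : Function.Injective ι := fun d d' h =>
    OnePoint.coe_injective (((ht _ d).2 rfl).symm.trans ((ht _ d').2 h))
  have hopen : ∀ d, IsOpen {ι d} := fun d => by
    convert (OnePoint.isOpen_singleton_coe d).preimage t.continuous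
    ext e
    exact (ht e d).symm
  have hpt : ∀ d, ∃ b, ∀ e, p.emb.value b e = if e = ι d then 1 else 0 := fun d => by
    obtain ⟨a, ha0, ha⟩ := p.isEssentialCompletion.1.isSupportDense {ι d}ᶜ (hopen d).isClosed_compl
      fun h => (h ▸ Set.mem_univ (ι d) : ι d ∈ ({ι d}ᶜ : Set E)) rfl
    obtain ⟨x, hx⟩ := Hom.exists_value_ne_zero p.isEssentialCompletion.1.1 ha0
    obtain rfl : x = ι d := by_contra fun h => hx (ha x h)
    refine ⟨(p.emb.value a (ι d))⁻¹ • a, fun e => ?_⟩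
    rw [p.emb.value_smul]
    split_ifs with h
    · rw [h, inv_mul_cancel₀ hx]
    · rw [ha e h, mul_zero]
  choose b hb using hpt
  let g : C(OnePoint D, ℝ) := f.1
  have hS := OnePoint.finite_ne_infty (f := g) f.2
  refine ⟨g OnePoint.infty • p.obj.unit +
    ∑ d ∈ hS.toFinset, (g d - g OnePoint.infty) • b d, ContinuousMap.coe_injective ?_⟩
  refine hι.equalizer (p.emb.continuous_value _) ((compHom t).continuous_value f)
    (funext fun d => ?_)
  change p.emb.value _ (ι d) = g (t (ι d))
  rw [(ht _ d).2 rfl, p.emb.value_add, p.emb.value_smul, p.emb.value_unit, p.emb.value_sum]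
  simp only [p.emb.value_smul, hb, hinj.eq_iff, mul_ite, mul_one, mul_zero, Finset.sum_ite_eq]
  split_ifs with h
  · ring
  · have : g d = g OnePoint.infty := by simpa using h
    rw [this, add_zero]

end PointDetection

end WStar

/-! ### The characterization of the minimum -/

theorem theoremF (E : Type u) [TopologicalSpace E] [CompactSpace E] [T2Space E]
    [ExtremallyDisconnected E] [Infinite E] :
    ((∃ m : WStar.EssPoset (WStar.ofC E), IsBot m) ↔
      ∃ (D : Type u) (_ : TopologicalSpace D) (_ : DiscreteTopology D),
        Nonempty (E ≃ₜ StoneCech D)) ∧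
    ∀ (D : Type u) [TopologicalSpace D] [DiscreteTopology D] (φ : E ≃ₜ StoneCech D),
      ∃ h : (WStar.compHom ((betaToAlpha D).comp (φ : C(E, StoneCech D)))).IsEssentialCompletion,
        IsBot (toAntisymmetrization (· ≤ ·)
          (⟨WStar.ofF (OnePoint D), _, h⟩ : WStar.EssCompletedBy (WStar.ofC E))) := by
  have key : ∀ (D : Type u) [TopologicalSpace D] [DiscreteTopology D] (φ : E ≃ₜ StoneCech D),
      ∃ h : (WStar.compHom ((betaToAlpha D).comp (φ : C(E, StoneCech D)))).IsEssentialCompletion,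
        IsBot (toAntisymmetrization (· ≤ ·)
          (⟨WStar.ofF (OnePoint D), _, h⟩ : WStar.EssCompletedBy (WStar.ofC E))) := by
    intro D _ _ φ
    have hι : DenseRange (φ.symm ∘ stoneCechUnit : D → E) :=
      φ.symm.surjective.denseRange.comp denseRange_stoneCechUnit φ.symm.continuous
    -- For finite `D` the dense image of `D` would be closed, making `E` finite.
    have : NoncompactSpace D := not_compactSpace_iff.1 fun hfin => by
      have := finite_of_compact_of_discrete (X := D)
      have hr : Set.range (φ.symm ∘ stoneCechUnit : D → E) = Set.univ := by
        rw [← (Set.finite_range _).isClosed.closure_eq, ← dense_iff_closure_eq]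
        exact hι
      exact Set.infinite_univ (hr ▸ Set.finite_range _)
    have ht : ∀ e (d : D), (betaToAlpha D).comp (φ : C(E, StoneCech D)) e = (d : OnePoint D) ↔
        e = (φ.symm ∘ stoneCechUnit) d := by
      intro e d
      rw [Function.comp_apply, ← φ.symm_apply_apply e, φ.symm.injective.eq_iff]
      constructor
      · intro he
        rw [φ.symm_apply_apply] at he
        exact eq_stoneCechUnit_of_stoneCechExtend_eq OnePoint.continuous_coe
          OnePoint.coe_injective
          (OnePoint.isOpen_singleton_coe d) he
      · intro he
        rw [φ.symm_apply_apply]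
        change stoneCechExtend OnePoint.continuous_coe (φ e) = d
        rw [he, stoneCechExtend_stoneCechUnit]
    refine ⟨(WStar.compHom_isEssential hι ht).isEssentialCompletion, fun m => ?_⟩
    induction m using Antisymmetrization.ind with | _ p
    rw [toAntisymmetrization_le_toAntisymmetrization_iff]
    exact WStar.EssCompletedBy.le_of_range_subset fun f => WStar.exists_emb_eq_compHom hι ht p f
  refine ⟨⟨fun ⟨m, hm⟩ => ?_, fun ⟨D, _, _, ⟨φ⟩⟩ => ?_⟩, key⟩
  · induction m using Antisymmetrization.ind with | _ p
    obtain ⟨hD, hφ⟩ := nonempty_homeomorph_stoneCech_of_dense_isolated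
      (WStar.dense_isolated_of_isBot (m := p) fun q => hm (toAntisymmetrization (· ≤ ·) q))
    exact ⟨_, _, hD, hφ⟩
  · obtain ⟨_, h⟩ := key D φ
    exact ⟨_, h⟩
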